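/- **Setting.** For a finite alphabet $B$, let $\mathcal F_B$ be the set of planar rooted forests (words of planar rooted trees) with vertices decorated by $B$; $\mathbf 1$ is the empty forest, $|\tau|$ the number of vertices of $\tau$, $[\tau]_a$ the tree obtained by joining the roots of $\tau$ to a new root decorated by $a$, and $\bullet_a=[\mathbf 1]_a$. Let ⧢ be the shuffle product of forests (as words of trees) and $\Delta$ the Munthe-Kaas–Wright coproduct, given by $\Delta(\mathbf 1)=\mathbf 1\otimes\mathbf 1$ and $\Delta(\tau[\sigma]_a)=\tau[\sigma]_a\otimes\mathbf 1+\Delta(\tau)\cdot(\mathrm{id}\otimes[\,\cdot\,]_a)\Delta(\sigma)$, where $\cdot$ is the shuffle on the left factor and concatenation on the right factor; $\star$ is the dual product, $\langle\xi\star\eta,\tau\rangle=\langle\xi\otimes\eta,\Delta(\tau)\rangle$. Fix $T>0$ and $\alpha\in(\frac13,\frac12]$, so that $N=\lfloor 1/\alpha\rfloor=2$. An *$\alpha$-Hölder planarly branched rough path* over $B$ is a family $\mathbf X_{s,t}$ ($s,t\in[0,T]$) of linear forms on the span of the forests with at most $N$ vertices such that, for forests in this range, $\langle\mathbf X_{s,u}\star\mathbf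 X_{u,t},\tau\rangle=\langle\mathbf X_{s,t},\tau\rangle$; $\langle\mathbf X_{s,t},\mathbf 1\rangle=1$; $\langle\mathbf X_{s,t},\sigma$ ⧢ $\tau\rangle=\langle\mathbf X_{s,t},\sigma\rangle\langle\mathbf X_{s,t},\tau\rangle$ if $|\sigma|+|\tau|\le N$; and $|\langle\mathbf X_{s,t},\tau\rangle|=O(|t-s|^{|\tau|\alpha})$ uniformly in $s\neq t$. For $B=\{1,\dots,d\}$ it is *above* $X:[0,T]\to\mathbb R^d$ if $\langle\mathbf X_{s,t},\bullet_i\rangle=X^i_t-X^i_s$ for all $i$. An *$\mathbf X$-controlled path* $\mathbf Y$ has values in the $\mathbb R^n$-valued linear combinations of forests with at most $N-1$ vertices, and satisfies $|\langle\tau,\mathbf Y_t\rangle-\langle\mathbf X_{s,t}\star\tau,\mathbf Y_s\rangle|=O(|t-s|^{(N-|\tau|)\alpha})$ for $|\tau|\le N-1$. A *rough integral* of $\mathbf Y$ against the component $a\in B$ is a function $I:[0,T]\to\mathbb R^n$ such that, with $\Xi_{s,t}=\sum_{|\tau|\le N-1}\langle\tau,\mathbf Y_s\rangle\langle\mathbf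 X_{s,t},[\tau]_a\rangle$, one has $|I_t-I_s-\Xi_{s,t}|=O(|t-s|^{(N+1)\alpha})$ uniformly in $s,t\in[0,T]$, and $I_t=\lim\sum_k\Xi_{t_k,t_{k+1}}$ over partitions of $[0,t]$ with mesh tending to $0$, for every $t\in[0,T]$; the integral from $s$ to $t$ is $I_t-I_s$. A *bracket extension* of a planarly branched rough path $\mathbf X$ over $\{1,\dots,d\}$ is a planarly branched rough path $\hat{\mathbf X}$ over the alphabet $\{1,\dots,d\}\cup\{(ij):1\le i,j\le d\}$ such that $\langle\hat{\mathbf X},\tau\rangle=\langle\mathbf X,\tau\rangle$ for all forests $\tau$ decorated by $\{1,\dots,d\}$; $\langle\hat{\mathbf X}_{s,t},\bullet_{(ij)}\rangle=\hat X^{(ij)}_{s,t}:=\langle\mathbf X_{s,t},\bullet_j\bullet_i-[\bullet_j]_i\rangle$; and $|\langle\hat{\mathbf X}_{s,t},\tau\rangle|=O(|t-s|^{\omega(\tau)\alpha})$ for $|\tau|\le N$, where $\omega(\tau)$ counts every vertex decorated by a letter $(ij)$ with weight two and every other vertex with weight one. **Theorem.** Let $\alpha\in(\frac13,\frac12]$,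 let $\mathbf X$ be an $\alpha$-Hölder planarly branched rough path above $X=(X^1,\dots,X^d)$, let $\hat{\mathbf X}$ be a bracket extension of $\mathbf X$, and let $F:\mathbb R^d\to\mathbb R^n$ be smooth. For a smooth $G:\mathbb R^d\to\mathbb R^n$ let $G(\mathbf X)$ have the coefficients $\langle\mathbf 1,G(\mathbf X_t)\rangle=G(X_t)$ and $\langle\bullet_k,G(\mathbf X_t)\rangle=\partial_kG(X_t)$ for $1\le k\le d$, all other coefficients being zero. Then the rough integrals $\int\partial_iF(X_r)\,dX^i_r$ (of the $\mathbf X$-controlled path $\partial_iF(\mathbf X)$) and $\int\partial_i\partial_jF(X_r)\,d\hat X^{(ij)}_r$ (of the $\hat{\mathbf X}$-controlled path $\partial_i\partial_jF(\mathbf X)$, against the component $(ij)$ of $\hat{\mathbf X}$) exist, and for all $s,t\in[0,T]$ $$F(X_t)-F(X_s)=\sum_{i=1}^d\int_s^t\partial_iF(X_r)\,dX^i_r+\sum_{i,j=1}^d\int_s^t\partial_i\partial_jF(X_r)\,d\hat X^{(ij)}_r .$$ -/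

import Mathlib

open scoped ContDiff

namespace PlanarRough

/-- Planar rooted trees with vertices decorated by `A`: a root decoration and the ordered list of
the subtrees sitting on the root. -/
inductive PTree (A : Type*) : Type _
  | node : A → List (PTree A) → PTree A

/-- Planar rooted forests: words of planar rooted trees. The empty word is the empty forest. -/
abbrev Forest (A : Type*) := List (PTree A)

/-- The one-vertex tree decorated by `a`. -/
abbrev dot {A : Type*} (a : A) : PTree A := .node a []

mutual
/-- Total weight of the vertices of a tree, a vertex decorated by `a` having weight `w a`. -/
def PTree.weight {A : Type*} (w : A → ℕ) : PTree A → ℕ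
  | .node a τ => w a + forestWeight w τ
/-- Total weight of the vertices of a forest. -/
def forestWeight {A : Type*} (w : A → ℕ) : List (PTree A) → ℕ
  | [] => 0
  | t :: τ => PTree.weight w t + forestWeight w τ
end

/-- The number of vertices of a forest. -/
def size {A : Type*} (τ : Forest A) : ℕ := forestWeight (fun _ => 1) τ

mutual
/-- Relabelling of the vertices of a tree. -/
def PTree.relabel {A B : Type*} (f : A → B) : PTree A → PTree B
  | .node a τ => .node (f a) (forestRelabel f τ)
/-- Relabelling of the vertices of a forest. -/
def forestRelabel {A B : Type*} (f : A → B) : List (PTree A) → List (PTree B)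
  | [] => []
  | t :: τ => PTree.relabel f t :: forestRelabel f τ
end

/-- The shuffle product of two forests (as words of trees), given as the list of its terms,
repeated according to multiplicity. -/
def shuffle {T : Type*} : List T → List T → List (List T)
  | [], τ => [τ]
  | σ, [] => [σ]
  | a :: σ, b :: τ =>
      ((shuffle σ (b :: τ)).map fun ρ => a :: ρ) ++ ((shuffle (a :: σ) τ).map fun ρ => b :: ρ)
termination_by σ τ => σ.length + τ.length

/-- Shuffle on the left tensor factor and concatenation on the right one:
`(σ₁ ⊗ σ₂) · (τ₁ ⊗ τ₂) = (σ₁ ⧢ τ₁) ⊗ (σ₂ τ₂)`, extended bilinearly to lists of terms. -/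
def shuffleConcat {A : Type*} (P Q : List (Forest A × Forest A)) : List (Forest A × Forest A) :=
  P.flatMap fun p => Q.flatMap fun q => (shuffle p.1 q.1).map fun ρ => (ρ, p.2 ++ q.2)

mutual
/-- For `t = [τ]_a` this is `(id ⊗ [·]_a) Δ(τ)`. -/
def PTree.trunkTerms {A : Type*} : PTree A → List (Forest A × Forest A)
  | .node a τ => (coprodAux [] [([], [])] τ).map fun p => (p.1, [PTree.node a p.2])
/-- Auxiliary recursion reading a forest from left to right; `pre` is the part already read and
`acc` its coproduct. -/
def coprodAux {A : Type*} (pre : List (PTree A)) (acc : List (List (PTree A) × List (PTree A))) :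
    List (PTree A) → List (List (PTree A) × List (PTree A))
  | [] => acc
  | t :: τ =>
      coprodAux (pre ++ [t]) ((pre ++ [t], []) :: shuffleConcat acc (PTree.trunkTerms t)) τ
end

/-- The Munthe-Kaas–Wright coproduct `Δ` (left admissible cuts, the pruned part on the left and the
trunk on the right) of a forest, as the list of its terms. It is the coproduct determined by
`Δ(1) = 1 ⊗ 1` and `Δ(τ [σ]_a) = τ [σ]_a ⊗ 1 + Δ(τ) · (id ⊗ [·]_a) Δ(σ)`, with the product
`shuffleConcat`: see `coprod_nil` and `coprod_concat`. -/
def coprod {A : Type*} (τ : Forest A) : List (Forest A × Forest A) := coprodAux [] [([], [])] τ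

theorem coprod_nil {A : Type*} : coprod ([] : Forest A) = [([], [])] := by
  simp [coprod, coprodAux]

theorem coprodAux_append {A : Type*} (τ σ pre : Forest A) (acc : List (Forest A × Forest A)) :
    coprodAux pre acc (τ ++ σ) = coprodAux (pre ++ τ) (coprodAux pre acc τ) σ := by
  induction τ generalizing pre acc with
  | nil => simp [coprodAux]
  | cons t τ ih => simp [coprodAux, ih]

theorem coprod_concat {A : Type*} (τ σ : Forest A) (a : A) :
    coprod (τ ++ [PTree.node a σ]) =
      (τ ++ [PTree.node a σ], []) ::
        shuffleConcat (coprod τ) ((coprod σ).map fun p => (p.1, [PTree.node a p.2])) := by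
  simp [coprod, coprodAux_append, coprodAux, PTree.trunkTerms]

/-- The product `⋆` dual to the Munthe-Kaas–Wright coproduct:
`⟨ξ ⋆ η, τ⟩ = ⟨ξ ⊗ η, Δ(τ)⟩`. An element of the graded dual is given by its coefficients `⟨ξ, τ⟩`
on the forests. -/
def star {A : Type*} (ξ η : Forest A → ℝ) (τ : Forest A) : ℝ :=
  ((coprod τ).map fun p => ξ p.1 * η p.2).sum

open Classical in
/-- The dual basis element attached to the forest `τ`. -/
noncomputable def basisElt {A : Type*} (τ : Forest A) : Forest A → ℝ := fun σ =>
  if σ = τ then 1 else 0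

/-- `⟨ξ, σ ⧢ τ⟩`. -/
def shufflePairing {A : Type*} (ξ : Forest A → ℝ) (σ τ : Forest A) : ℝ :=
  ((shuffle σ τ).map ξ).sum

/-- The truncation level `N = ⌊1/α⌋`. -/
noncomputable def level (α : ℝ) : ℕ := ⌊1 / α⌋₊

/-- `α`-Hölder planarly branched rough paths on `[0,T]` over the alphabet `A`; `X s t τ` is the
coefficient `⟨X_{s,t}, τ⟩`. The values lie in the dual truncated at level `N = ⌊1/α⌋`, so they vanish
on forests with more than `N` vertices; they are (truncated) characters of the shuffle product. -/
structure IsRoughPath {A : Type*} (α T : ℝ) (X : ℝ → ℝ → Forest A → ℝ) : Prop where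
  truncated : ∀ s ∈ Set.Icc 0 T, ∀ t ∈ Set.Icc 0 T, ∀ τ, level α < size τ → X s t τ = 0
  chen : ∀ s ∈ Set.Icc 0 T, ∀ u ∈ Set.Icc 0 T, ∀ t ∈ Set.Icc 0 T, ∀ τ, size τ ≤ level α →
    star (X s u) (X u t) τ = X s t τ
  unit : ∀ s ∈ Set.Icc 0 T, ∀ t ∈ Set.Icc 0 T, X s t [] = 1
  shuffle : ∀ s ∈ Set.Icc 0 T, ∀ t ∈ Set.Icc 0 T, ∀ σ τ, size σ + size τ ≤ level α →
    shufflePairing (X s t) σ τ = X s t σ * X s t τ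
  holder : ∀ τ, size τ ≤ level α → ∃ C : ℝ, ∀ s ∈ Set.Icc 0 T, ∀ t ∈ Set.Icc 0 T, s ≠ t →
    |X s t τ| ≤ C * |t - s| ^ ((size τ : ℝ) * α)

/-- `X` is above the path `x : [0,T] → ℝ^d`. -/
def IsAbove {d : ℕ} (T : ℝ) (X : ℝ → ℝ → Forest (Fin d) → ℝ)
    (x : ℝ → EuclideanSpace ℝ (Fin d)) : Prop :=
  ∀ s ∈ Set.Icc 0 T, ∀ t ∈ Set.Icc 0 T, ∀ i, X s t [dot i] = x t i - x s i

/-- `⟨X_{s,t} ⋆ τ, y⟩` for a vector `y` of the (vector-valued) Hopf algebra, given as a finite linear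
combination of forests with coefficients in `E`. -/
noncomputable def starPairing {A E : Type*} [AddCommGroup E] [Module ℝ E]
    (ξ : Forest A → ℝ) (τ : Forest A) (y : Forest A →₀ E) : E :=
  y.sum fun σ e => star ξ (basisElt τ) σ • e

/-- `X`-controlled planarly branched rough paths with values in `E`: `Y t τ` is the coefficient
`⟨τ, Y_t⟩`; `Y_t` lives on forests with at most `N - 1` vertices and the remainders satisfy
`⟨τ, Y_t⟩ - ⟨X_{s,t} ⋆ τ, Y_s⟩ = O(|t-s|^{(N-|τ|)α})`. -/
structure IsControlled {A E : Type*} [NormedAddCommGroup E] [NormedSpace ℝ E] (α T : ℝ)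
    (X : ℝ → ℝ → Forest A → ℝ) (Y : ℝ → Forest A →₀ E) : Prop where
  truncated : ∀ t ∈ Set.Icc 0 T, ∀ τ, level α ≤ size τ → Y t τ = 0
  remainder : ∀ τ, size τ < level α → ∃ C : ℝ, ∀ s ∈ Set.Icc 0 T, ∀ t ∈ Set.Icc 0 T,
    ‖Y t τ - starPairing (X s t) τ (Y s)‖ ≤ C * |t - s| ^ (((level α : ℝ) - size τ) * α)

/-- The compensated increment `∑_τ ⟨τ, Y_s⟩ ⟨X_{s,t}, [τ]_a⟩`. -/
noncomputable def germ {A E : Type*} [AddCommGroup E] [Module ℝ E]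
    (X : ℝ → ℝ → Forest A → ℝ) (Y : ℝ → Forest A →₀ E) (a : A) (s t : ℝ) : E :=
  (Y s).sum fun τ e => X s t [PTree.node a τ] • e

/-- The sums `∑ Ξ(p_k, p_{k+1})` over partitions `s = p_0 ≤ ⋯ ≤ p_m = t` converge to `L` as the mesh
tends to zero. -/
def HasMeshLimit {E : Type*} [NormedAddCommGroup E] (Ξ : ℝ → ℝ → E) (s t : ℝ) (L : E) : Prop :=
  ∀ ε > 0, ∃ δ > 0, ∀ (m : ℕ) (p : ℕ → ℝ), Monotone p → p 0 = s → p m = t →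
    (∀ k < m, p (k + 1) - p k < δ) →
    ‖∑ k ∈ Finset.range m, Ξ (p k) (p (k + 1)) - L‖ < ε

/-- `I` is the rough integral `t ↦ ∫_0^t Y dX^a` on `[0,T]` of the `X`-controlled path `Y` against the
component `a`; the integral from `s` to `t` is `I t - I s`. -/
structure IsRoughIntegral {A E : Type*} [NormedAddCommGroup E] [NormedSpace ℝ E] (α T : ℝ)
    (X : ℝ → ℝ → Forest A → ℝ) (Y : ℝ → Forest A →₀ E) (a : A) (I : ℝ → E) : Prop where
  controlled : IsControlled α T X Y
  estimate : ∃ C : ℝ, ∀ s ∈ Set.Icc 0 T, ∀ t ∈ Set.Icc 0 T,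
    ‖I t - I s - germ X Y a s t‖ ≤ C * |t - s| ^ (((level α : ℝ) + 1) * α)
  limit : ∀ t ∈ Set.Icc 0 T, HasMeshLimit (germ X Y a) 0 t (I t)

/-- The alphabet `{1,…,d}` enlarged by the letters `(ij)`, `1 ≤ i,j ≤ d`. -/
abbrev ExtLetter (d : ℕ) := Fin d ⊕ (Fin d × Fin d)

/-- The letters `i` have weight one, the letters `(ij)` have weight two. -/
def letterWeight {d : ℕ} : ExtLetter d → ℕ
  | .inl _ => 1
  | .inr _ => 2

/-- The increment `⟨X_{s,t}, •_j •_i - [•_j]_i⟩` of the bracket path `(ij)`. -/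
def bracket {d : ℕ} (X : ℝ → ℝ → Forest (Fin d) → ℝ) (i j : Fin d) (s t : ℝ) : ℝ :=
  X s t [dot j, dot i] - X s t [PTree.node i [dot j]]

/-- `Xhat` is a bracket extension of `X`: a planarly branched rough path over the enlarged alphabet
that extends `X`, whose component `(ij)` is the bracket path, and which is homogeneous when each
letter `(ij)` is counted with weight two. -/
structure IsBracketExtension {d : ℕ} (α T : ℝ) (X : ℝ → ℝ → Forest (Fin d) → ℝ)
    (Xhat : ℝ → ℝ → Forest (ExtLetter d) → ℝ) : Prop where
  isRoughPath : IsRoughPath α T Xhat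
  extends_path : ∀ s ∈ Set.Icc 0 T, ∀ t ∈ Set.Icc 0 T, ∀ τ : Forest (Fin d),
    Xhat s t (forestRelabel Sum.inl τ) = X s t τ
  bracket_path : ∀ s ∈ Set.Icc 0 T, ∀ t ∈ Set.Icc 0 T, ∀ i j,
    Xhat s t [dot (Sum.inr (i, j))] = bracket X i j s t
  homogeneous : ∀ τ, size τ ≤ level α → ∃ C : ℝ, ∀ s ∈ Set.Icc 0 T, ∀ t ∈ Set.Icc 0 T, s ≠ t →
    |Xhat s t τ| ≤ C * |t - s| ^ ((forestWeight letterWeight τ : ℝ) * α)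

/-- The `i`-th partial derivative of a map on `ℝ^d`. -/
noncomputable def partialD {d : ℕ} {E : Type*} [NormedAddCommGroup E] [NormedSpace ℝ E] (i : Fin d)
    (F : EuclideanSpace ℝ (Fin d) → E) (x : EuclideanSpace ℝ (Fin d)) : E :=
  fderiv ℝ F x (EuclideanSpace.single i 1)

/-- The controlled path `F(X)` above `t ↦ F(x_t)` at truncation level two: its coefficients are
`F(x_t)` on the empty forest, `∂_i F(x_t)` on `•_i`, and zero on all other forests. -/
noncomputable def lift {d : ℕ} {E : Type*} [NormedAddCommGroup E] [NormedSpace ℝ E]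
    (F : EuclideanSpace ℝ (Fin d) → E) (x : ℝ → EuclideanSpace ℝ (Fin d)) (t : ℝ) :
    Forest (Fin d) →₀ E :=
  Finsupp.single [] (F (x t)) + ∑ i, Finsupp.single [dot i] (partialD i F (x t))

/-- A path controlled over the alphabet `{1,…,d}`, seen over the enlarged alphabet: the
coefficients of forests containing a letter `(ij)` are zero. -/
noncomputable def extend {d : ℕ} {E : Type*} [AddCommMonoid E]
    (Y : ℝ → Forest (Fin d) →₀ E) (t : ℝ) : Forest (ExtLetter d) →₀ E :=
  (Y t).mapDomain (forestRelabel Sum.inl)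

end PlanarRough

-- At level two everything is decided modulo errors of order `3 * α`, and `3 * α > 1` makes such
-- errors sum to zero over fine partitions.
--
-- The germ of the integral against `X^i` is `X^i ∂_iF + ∑_k [•_k]_i ∂_k∂_iF`. The germ of the
-- `(ij)` integral is `(•_j•_i - [•_j]_i) ∂_i∂_jF` plus terms `[•_k]_(ij) ∂_k∂_i∂_jF`, which have
-- weight three and are negligible. Second derivatives commute, so the ladders cancel in the sum.
-- What remains of second order is `∑ •_j•_i ∂_i∂_jF`; its symmetrization, by the shuffle relation,
-- is half the second differential of `F` at the increment of `X`. The germs thus add up to the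
-- second-order Taylor polynomial (`sum_bracket_add_sum_ladder`, `hasOrder_ito`). Subtracting the
-- integrals from `F(X)` leaves a path with increments of order `3 * α`, hence a constant one
-- (`eq_of_norm_sub_le_rpow`).
--
-- The integrals exist by the sewing lemma (`exists_path`, `hasMeshLimit_of_norm_sub_le`). By Chen's
-- relation the additivity defect of a germ consists of products of a controlled-path remainder and
-- a rough path coefficient on consecutive intervals, of orders `2 * α + α` and `α + 2 * α`
-- (`isAlmostAdditive_germ`).

namespace PlanarRough

open Filter Topology Set

-- Sewing: the maximal inequality

/-- The constant of the sewing lemma. -/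
noncomputable def sewingConst (C θ : ℝ) : ℝ := 2 * C / (1 - 2 ^ (1 - θ))

theorem two_rpow_lt_one {θ : ℝ} (hθ : 1 < θ) : (2 : ℝ) ^ (1 - θ) < 1 :=
  Real.rpow_lt_one_of_one_lt_of_neg (by norm_num) (by linarith)

theorem sewingConst_nonneg {C θ : ℝ} (hC : 0 ≤ C) (hθ : 1 < θ) :
    0 ≤ sewingConst C θ :=
  div_nonneg (by linarith) (by linarith [two_rpow_lt_one hθ])

theorem two_mul_half_rpow {L θ : ℝ} (hL : 0 ≤ L) :
    2 * (L / 2) ^ θ = 2 ^ (1 - θ) * L ^ θ := by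
  rw [Real.div_rpow hL (by norm_num), Real.rpow_sub (by norm_num), Real.rpow_one]
  ring

/-- A partition need not have a point near the midpoint of its interval, but some step straddles it.
Removing that step leaves two pieces of at most half the length. -/
theorem exists_middle_step {p : ℕ → ℝ} (hp : Monotone p) {a b : ℕ}
    (hab : a < b) : ∃ j, a ≤ j ∧ j < b ∧ p j - p a ≤ (p b - p a) / 2 ∧
      p b - p (j + 1) ≤ (p b - p a) / 2 := by
  have hL : p a ≤ p b := hp hab.le
  have hex : ∃ m, a < m ∧ (p b - p a) / 2 ≤ p m - p a := ⟨b, hab, by linarith⟩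
  classical
  obtain ⟨h1, h2⟩ := Nat.find_spec hex
  have h3 : Nat.find hex ≤ b := Nat.find_min' hex ⟨hab, by linarith⟩
  have h4 := fun k (hk : k < Nat.find hex) => Nat.find_min hex hk
  generalize Nat.find hex = m at *
  obtain ⟨j, rfl⟩ : ∃ j, m = j + 1 := ⟨m - 1, by omega⟩
  refine ⟨j, by omega, by omega, ?_, by linarith⟩
  -- Minimality of `j + 1` only speaks of indices above `a`, so `j = a` is separate.
  rcases (show a ≤ j by omega).eq_or_lt with rfl | haj
  · linarith
  · have := h4 j (by omega)
    simp only [haj, true_and, not_le] at this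
    exact this.le

/-- The hypothesis of the sewing lemma on `[0, T]`: the germ `Ξ` is additive up to an error of
order `θ`. -/
def IsAlmostAdditive {E : Type*} [NormedAddCommGroup E] (T C θ : ℝ) (Ξ : ℝ → ℝ → E) : Prop :=
  ∀ s ∈ Icc 0 T, ∀ u ∈ Icc 0 T, ∀ t ∈ Icc 0 T,
    ‖Ξ s t - Ξ s u - Ξ u t‖ ≤ C * (|u - s| + |t - u|) ^ θ

namespace IsAlmostAdditive

variable {E : Type*} [NormedAddCommGroup E] {T C θ : ℝ} {Ξ : ℝ → ℝ → E}

theorem self_eq_zero (h : IsAlmostAdditive T C θ Ξ) (hθ : 1 < θ) {t : ℝ} (ht : t ∈ Icc 0 T) :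
    Ξ t t = 0 := by
  have := h t ht t ht t ht
  simpa [Real.zero_rpow (by linarith : θ ≠ 0)] using this

theorem norm_le_of_le (h : IsAlmostAdditive T C θ Ξ) {s u t : ℝ} (hs : 0 ≤ s) (hsu : s ≤ u)
    (hut : u ≤ t) (ht : t ≤ T) : ‖Ξ s t - Ξ s u - Ξ u t‖ ≤ C * (t - s) ^ θ := by
  have := h s ⟨hs, by linarith⟩ u ⟨by linarith, by linarith⟩ t ⟨by linarith, ht⟩
  rwa [abs_of_nonneg (by linarith), abs_of_nonneg (by linarith), sub_add_sub_cancel'] at this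

/-- The maximal inequality of the sewing lemma. -/
theorem norm_sum_sub_le (h : IsAlmostAdditive T C θ Ξ) (hC : 0 ≤ C) (hθ : 1 < θ) {p : ℕ → ℝ}
    (hp : Monotone p) {a b : ℕ} (hab : a ≤ b) (ha : 0 ≤ p a) (hb : p b ≤ T) :
    ‖∑ k ∈ Finset.Ico a b, Ξ (p k) (p (k + 1)) - Ξ (p a) (p b)‖
      ≤ sewingConst C θ * (p b - p a) ^ θ := by
  obtain ⟨n, hn⟩ : ∃ n, n = b - a := ⟨_, rfl⟩
  induction n using Nat.strong_induction_on generalizing a b with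
  | _ n ih =>
  have hK := sewingConst_nonneg hC hθ
  rcases hab.eq_or_lt with rfl | hlt
  · simp [h.self_eq_zero hθ ⟨ha, hb⟩, Real.zero_rpow (by linarith : θ ≠ 0)]
  obtain ⟨j, haj, hjb, h1, h2⟩ := exists_middle_step hp hlt
  have pj := hp haj
  have pj' := hp (Nat.le_succ j)
  have pb : p (j + 1) ≤ p b := hp hjb
  simp only [Nat.succ_eq_add_one] at pj'
  have i1 := ih (j - a) (by omega) haj ha (by linarith) rfl
  have i2 := ih (b - (j + 1)) (by omega) hjb (by linarith) hb rfl
  have d1 := h.norm_le_of_le ha (pj.trans pj') pb hb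
  have d2 := h.norm_le_of_le ha pj pj' (by linarith)
  have hL : 0 ≤ p b - p a := by linarith
  have e1 : (p j - p a) ^ θ ≤ ((p b - p a) / 2) ^ θ :=
    Real.rpow_le_rpow (by linarith) h1 (by linarith)
  have e2 : (p b - p (j + 1)) ^ θ ≤ ((p b - p a) / 2) ^ θ :=
    Real.rpow_le_rpow (by linarith) h2 (by linarith)
  have e3 : (p (j + 1) - p a) ^ θ ≤ (p b - p a) ^ θ :=
    Real.rpow_le_rpow (by linarith) (by linarith) (by linarith)
  -- Splitting off the middle step costs two additivity defects, one at each of its endpoints.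
  have hsum : ∑ k ∈ Finset.Ico a b, Ξ (p k) (p (k + 1)) - Ξ (p a) (p b)
      = (∑ k ∈ Finset.Ico a j, Ξ (p k) (p (k + 1)) - Ξ (p a) (p j))
        + (∑ k ∈ Finset.Ico (j + 1) b, Ξ (p k) (p (k + 1)) - Ξ (p (j + 1)) (p b))
        - (Ξ (p a) (p b) - Ξ (p a) (p (j + 1)) - Ξ (p (j + 1)) (p b))
        - (Ξ (p a) (p (j + 1)) - Ξ (p a) (p j) - Ξ (p j) (p (j + 1))) := by
    rw [← Finset.sum_Ico_consecutive _ haj hjb.le, Finset.sum_eq_sum_Ico_succ_bot hjb]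
    abel
  -- The fixed-point equation that dictates the constant: the two halves contribute the factor `2 ^
  -- (1 - θ) < 1`, the two defects contribute `2 * C`.
  have hKeq : sewingConst C θ * 2 ^ (1 - θ) + 2 * C = sewingConst C θ := by
    have := two_rpow_lt_one hθ
    have h0 : (1 : ℝ) - 2 ^ (1 - θ) ≠ 0 := by linarith
    unfold sewingConst
    field_simp
    ring
  rw [hsum]
  calc _ ≤ sewingConst C θ * (p j - p a) ^ θ + sewingConst C θ * (p b - p (j + 1)) ^ θ
        + C * (p b - p a) ^ θ + C * (p (j + 1) - p a) ^ θ :=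
        (norm_sub_le _ _).trans (add_le_add ((norm_sub_le _ _).trans
          (add_le_add ((norm_add_le _ _).trans (add_le_add i1 i2)) d1)) d2)
    _ ≤ sewingConst C θ * ((p b - p a) / 2) ^ θ + sewingConst C θ * ((p b - p a) / 2) ^ θ
        + C * (p b - p a) ^ θ + C * (p b - p a) ^ θ := by gcongr
    _ = sewingConst C θ * (2 * ((p b - p a) / 2) ^ θ) + 2 * C * (p b - p a) ^ θ := by ring
    _ = (sewingConst C θ * 2 ^ (1 - θ) + 2 * C) * (p b - p a) ^ θ := by
        rw [two_mul_half_rpow hL]; ring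
    _ = _ := by rw [hKeq]

end IsAlmostAdditive

-- Sewing: construction of the path from dyadic sums

/-- Step `T / 2 ^ n` of the `n`-th dyadic grid of `[0, T]`. -/
noncomputable def dyadicStep (T : ℝ) (n : ℕ) : ℝ := T / 2 ^ n

theorem dyadicStep_nonneg {T : ℝ} (hT : 0 ≤ T) (n : ℕ) : 0 ≤ dyadicStep T n := by
  unfold dyadicStep; positivity

/-- Sum of the germ along the dyadic grid of `[0, T]` stopped at `t`. -/
noncomputable def dyadicSum {E : Type*} [AddCommMonoid E] (T : ℝ) (Ξ : ℝ → ℝ → E) (n : ℕ) (t : ℝ) :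
    E :=
  ∑ k ∈ Finset.range (2 ^ n),
    Ξ (min (k * dyadicStep T n) t) (min ((k + 1 : ℕ) * dyadicStep T n) t)

theorem tendsto_dyadicStep (T : ℝ) : Tendsto (dyadicStep T) atTop (𝓝 0) := by
  unfold dyadicStep
  exact tendsto_const_nhds.div_atTop (tendsto_pow_atTop_atTop_of_one_lt (by norm_num))

theorem monotone_grid {h : ℝ} (hh : 0 ≤ h) : Monotone fun k : ℕ => (k : ℝ) * h := fun a b hab =>
  mul_le_mul_of_nonneg_right (by exact_mod_cast hab) hh

theorem min_sub_min_le {a b t : ℝ} (hab : a ≤ b) : min b t - min a t ≤ b - a := by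
  rcases min_cases a t with h | h <;> rcases min_cases b t with h' | h' <;> linarith

theorem sum_range_two_mul {E : Type*} [AddCommMonoid E] (f : ℕ → E) (n : ℕ) :
    ∑ k ∈ Finset.range (2 * n), f k = ∑ k ∈ Finset.range n, (f (2 * k) + f (2 * k + 1)) := by
  induction n with
  | zero => simp
  | succ n ih => rw [mul_add, mul_one, Finset.sum_range_succ, Finset.sum_range_succ, ih,
      Finset.sum_range_succ, add_assoc]

namespace IsAlmostAdditive

variable {E : Type*} [NormedAddCommGroup E] {T C θ : ℝ} {Ξ : ℝ → ℝ → E}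

/-- Halving each of the `2 ^ n` cells costs one defect of order `(T / 2 ^ n) ^ θ` per cell; as `θ >
1`, the totals decay geometrically. -/
theorem dist_dyadicSum_succ_le (h : IsAlmostAdditive T C θ Ξ) (hT : 0 ≤ T) (hC : 0 ≤ C)
    (hθ : 1 < θ) {t : ℝ} (ht : t ∈ Icc 0 T) (n : ℕ) :
    dist (dyadicSum T Ξ n t) (dyadicSum T Ξ (n + 1) t) ≤ C * T ^ θ * (2 ^ (1 - θ)) ^ n := by
  have hh := dyadicStep_nonneg hT (n + 1)
  have hstep : dyadicStep T n = 2 * dyadicStep T (n + 1) := by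
    unfold dyadicStep; rw [pow_succ]; field_simp
  have hs : dyadicSum T Ξ (n + 1) t = ∑ k ∈ Finset.range (2 ^ n),
      (Ξ (min (k * dyadicStep T n) t) (min ((2 * k + 1 : ℕ) * dyadicStep T (n + 1)) t)
        + Ξ (min ((2 * k + 1 : ℕ) * dyadicStep T (n + 1)) t)
          (min ((k + 1 : ℕ) * dyadicStep T n) t)) := by
    unfold dyadicSum
    rw [pow_succ, mul_comm, sum_range_two_mul]
    refine Finset.sum_congr rfl fun k _ => ?_
    rw [hstep]
    congr 3 <;> push_cast <;> ring
  rw [hs, dyadicSum, dist_eq_norm, ← Finset.sum_sub_distrib]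
  have hterm : ∀ k ∈ Finset.range (2 ^ n),
      ‖Ξ (min (k * dyadicStep T n) t) (min ((k + 1 : ℕ) * dyadicStep T n) t) -
        (Ξ (min (k * dyadicStep T n) t) (min ((2 * k + 1 : ℕ) * dyadicStep T (n + 1)) t)
        + Ξ (min ((2 * k + 1 : ℕ) * dyadicStep T (n + 1)) t)
          (min ((k + 1 : ℕ) * dyadicStep T n) t))‖ ≤ C * (dyadicStep T n) ^ θ := by
    intro k _
    rw [← sub_sub]
    have a1 : (k : ℝ) * dyadicStep T n ≤ (2 * k + 1 : ℕ) * dyadicStep T (n + 1) := by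
      rw [hstep]; push_cast; nlinarith
    have a2 : (2 * k + 1 : ℕ) * dyadicStep T (n + 1) ≤ (k + 1 : ℕ) * dyadicStep T n := by
      rw [hstep]; push_cast; nlinarith
    have a3 := min_sub_min_le (t := t) (a1.trans a2)
    have a0 : 0 ≤ (k : ℝ) * dyadicStep T n := mul_nonneg k.cast_nonneg (dyadicStep_nonneg hT n)
    refine (h.norm_le_of_le (le_min a0 ht.1) (min_le_min_right _ a1) (min_le_min_right _ a2)
      ((min_le_right _ _).trans ht.2)).trans ?_
    gcongr
    · exact sub_nonneg.2 (min_le_min_right _ (a1.trans a2))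
    · refine a3.trans (le_of_eq ?_)
      push_cast; ring
  refine (norm_sum_le_of_le _ hterm).trans (le_of_eq ?_)
  simp only [Finset.sum_const, Finset.card_range, nsmul_eq_mul, dyadicStep]
  rw [Real.div_rpow hT (by positivity), ← Real.rpow_natCast, ← Real.rpow_natCast,
    ← Real.rpow_mul (by norm_num), ← Real.rpow_mul (by norm_num), sub_mul, one_mul,
    Real.rpow_sub (by norm_num), mul_comm θ]
  push_cast
  rw [Real.rpow_natCast]
  ring

/-- Up to one defect, the dyadic sums have additive increments along the grid stopped at `s`
and `t`. -/
theorem norm_dyadicSum_sub_sub_le (h : IsAlmostAdditive T C θ Ξ) (hT : 0 ≤ T) (hC : 0 ≤ C)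
    (hθ : 1 < θ) {s t : ℝ} (hs : 0 ≤ s) (hst : s ≤ t) (ht : t ≤ T) (n : ℕ) :
    ‖dyadicSum T Ξ n t - dyadicSum T Ξ n s - Ξ s t‖
      ≤ C * (dyadicStep T n) ^ θ + sewingConst C θ * (t - s) ^ θ := by
  set w := dyadicStep T n with hw
  have hw0 : 0 ≤ w := dyadicStep_nonneg hT n
  -- The grid clamped to `[s, t]` is a partition of `[s, t]`, to which the maximal inequality
  -- applies.
  set p : ℕ → ℝ := fun k => max s (min (k * w) t) with hpdef
  have hp : Monotone p := fun a b hab =>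
    max_le_max_left _ (min_le_min_right _ (monotone_grid hw0 hab))
  have hp0 : p 0 = s := by
    simp [hpdef, hs.trans hst, hs]
  have hpn : p (2 ^ n) = t := by
    have : ((2 ^ n : ℕ) : ℝ) * w = T := by
      rw [hw, dyadicStep]; push_cast; field_simp
    simp only [hpdef, this, min_eq_right ht, max_eq_right hst]
  have hmax := h.norm_sum_sub_le hC hθ hp (a := 0) (b := 2 ^ n) (Nat.zero_le _)
    (by rw [hp0]; exact hs) (by rw [hpn]; exact ht)
  rw [hp0, hpn, ← Finset.range_eq_Ico] at hmax
  -- A cell to the left of `s` contributes equally to both stopped sums, and one to the right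
  -- contributes only to the sum stopped at `t`. Only a cell with `s` in its interior leaves a
  -- defect.
  have hterm : ∀ k ∈ Finset.range (2 ^ n),
      ‖Ξ (min (k * w) t) (min ((k + 1 : ℕ) * w) t) - Ξ (min (k * w) s) (min ((k + 1 : ℕ) * w) s)
        - Ξ (p k) (p (k + 1))‖ ≤ if k * w < s ∧ s < (k + 1 : ℕ) * w then C * w ^ θ else 0 := by
    intro k _
    have hkw : 0 ≤ (k : ℝ) * w := by positivity
    have hk1 : (k : ℝ) * w ≤ (k + 1 : ℕ) * w := monotone_grid hw0 (Nat.le_succ k)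
    have hss := h.self_eq_zero hθ (t := s) ⟨hs, hst.trans ht⟩
    have htt := h.self_eq_zero hθ (t := t) ⟨hs.trans hst, ht⟩
    simp only [hpdef]
    split_ifs with hc
    · obtain ⟨c1, c2⟩ := hc
      rw [min_eq_left (c1.le.trans hst), min_eq_left c1.le, min_eq_right c2.le, max_eq_left c1.le,
        max_eq_right (le_min c2.le hst)]
      refine (h.norm_le_of_le hkw c1.le (le_min c2.le hst)
        ((min_le_right _ _).trans ht)).trans ?_
      gcongr
      · linarith [le_min c2.le hst]
      · have := min_le_left ((k + 1 : ℕ) * w) t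
        have e : ((k + 1 : ℕ) : ℝ) * w = k * w + w := by push_cast; ring
        linarith
    · rw [not_and_or, not_lt, not_lt] at hc
      rcases hc with hc | hc
      · rw [min_eq_right hc, min_eq_right (hc.trans hk1), hss, max_eq_right (le_min hc hst),
          max_eq_right (le_min (hc.trans hk1) hst)]
        simp
      · have hc' := hk1.trans hc
        rw [min_eq_left (hc.trans hst), min_eq_left (hc'.trans hst), min_eq_left hc,
          min_eq_left hc', max_eq_left hc, max_eq_left hc', hss]
        simp
  have hcard : ((Finset.range (2 ^ n)).filter fun k : ℕ =>
      (k : ℝ) * w < s ∧ s < (k + 1 : ℕ) * w).card ≤ 1 := by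
    rw [Finset.card_le_one]
    have key : ∀ a b : ℕ, (a : ℝ) * w < s → s < (b + 1 : ℕ) * w → a ≤ b := by
      intro a b ha hb
      have := lt_of_mul_lt_mul_right (ha.trans hb) hw0
      exact Nat.lt_succ_iff.1 (by exact_mod_cast this)
    simp only [Finset.mem_filter]
    rintro a ⟨-, a1, a2⟩ b ⟨-, b1, b2⟩
    exact le_antisymm (key a b a1 b2) (key b a b1 a2)
  have hdef := norm_sum_le_of_le _ hterm
  rw [← Finset.sum_filter, Finset.sum_const, nsmul_eq_mul] at hdef
  have hdef' : _ ≤ C * w ^ θ := hdef.trans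
    (mul_le_of_le_one_left (by positivity) (by exact_mod_cast hcard))
  rw [Finset.sum_sub_distrib, Finset.sum_sub_distrib] at hdef'
  have := (norm_add_le _ _).trans (add_le_add hdef' hmax)
  rwa [sub_add_sub_cancel] at this

/-- The sewing lemma: an almost additive germ is close to the increments of a path. -/
theorem exists_path [CompleteSpace E] (h : IsAlmostAdditive T C θ Ξ) (hT : 0 ≤ T) (hC : 0 ≤ C)
    (hθ : 1 < θ) : ∃ I : ℝ → E, I 0 = 0 ∧ ∀ s ∈ Icc 0 T, ∀ t ∈ Icc 0 T, s ≤ t →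
      ‖I t - I s - Ξ s t‖ ≤ sewingConst C θ * (t - s) ^ θ := by
  have hlim : ∀ t, ∃ L, t ∈ Icc 0 T → Tendsto (fun n => dyadicSum T Ξ n t) atTop (𝓝 L) := by
    intro t
    by_cases ht : t ∈ Icc 0 T
    · obtain ⟨L, hL⟩ := cauchySeq_tendsto_of_complete (cauchySeq_of_le_geometric _ _
        (two_rpow_lt_one hθ) (h.dist_dyadicSum_succ_le hT hC hθ ht))
      exact ⟨L, fun _ => hL⟩
    · exact ⟨0, fun h' => absurd h' ht⟩
  choose J hJ using hlim
  -- Subtracting `J 0` normalizes the path at the origin without changing increments.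
  refine ⟨fun t => J t - J 0, sub_self _, fun s hs t ht hst => ?_⟩
  rw [sub_sub_sub_cancel_right]
  have l1 := (((hJ t ht).sub (hJ s hs)).sub_const (Ξ s t)).norm
  have l2 : Tendsto (fun n => C * (dyadicStep T n) ^ θ + sewingConst C θ * (t - s) ^ θ) atTop
      (𝓝 (C * (0 : ℝ) ^ θ + sewingConst C θ * (t - s) ^ θ)) :=
    (((tendsto_dyadicStep T).rpow_const (Or.inr (by linarith))).const_mul C).add_const _
  rw [Real.zero_rpow (by linarith), mul_zero, zero_add] at l2
  exact le_of_tendsto_of_tendsto' l1 l2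
    fun n => h.norm_dyadicSum_sub_sub_le hT hC hθ hs.1 hst ht.2 n

end IsAlmostAdditive

/-- Riemann-type sums of a germ converge to any path that the germ approximates to an order
larger than one. -/
theorem hasMeshLimit_of_norm_sub_le {E : Type*} [NormedAddCommGroup E] {T K θ : ℝ}
    {Ξ : ℝ → ℝ → E} {I : ℝ → E} (hK : 0 ≤ K) (hθ : 1 < θ) (h0 : I 0 = 0)
    (hI : ∀ s ∈ Icc 0 T, ∀ t ∈ Icc 0 T, s ≤ t → ‖I t - I s - Ξ s t‖ ≤ K * (t - s) ^ θ)
    {t : ℝ} (ht : t ∈ Icc 0 T) : HasMeshLimit Ξ 0 t (I t) := by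
  intro ε hε
  have hlim : Tendsto (fun δ : ℝ => K * δ ^ (θ - 1) * t) (𝓝[>] 0) (𝓝 0) := by
    have : Tendsto (fun δ : ℝ => δ ^ (θ - 1)) (𝓝 0) (𝓝 0) := by
      have := (Real.continuousAt_rpow_const 0 (θ - 1) (Or.inr (by linarith))).tendsto
      rwa [Real.zero_rpow (by linarith)] at this
    simpa using (((this.mono_left nhdsWithin_le_nhds).const_mul K).mul_const t)
  obtain ⟨δ, hδε, hδ⟩ := ((hlim.eventually_lt_const hε).and self_mem_nhdsWithin).exists
  refine ⟨δ, hδ, fun m p hp hp0 hpm hmesh => ?_⟩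
  have hδ : 0 < δ := hδ
  have hmem : ∀ k ≤ m, p k ∈ Icc 0 T := fun k hk =>
    ⟨hp0 ▸ hp (Nat.zero_le k), (hp hk).trans (hpm ▸ ht.2)⟩
  have hIt : I t = ∑ k ∈ Finset.range m, (I (p (k + 1)) - I (p k)) := by
    rw [Finset.sum_range_sub (fun k => I (p k)), hp0, hpm, h0, sub_zero]
  rw [hIt, ← Finset.sum_sub_distrib]
  have hterm : ∀ k ∈ Finset.range m, ‖Ξ (p k) (p (k + 1)) - (I (p (k + 1)) - I (p k))‖
      ≤ K * δ ^ (θ - 1) * (p (k + 1) - p k) := by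
    intro k hk
    rw [Finset.mem_range] at hk
    have hpk := hp (Nat.le_succ k)
    rw [norm_sub_rev]
    refine (hI _ (hmem k hk.le) _ (hmem (k + 1) hk) hpk).trans ?_
    have hx : 0 ≤ p (k + 1) - p k := sub_nonneg.2 hpk
    have : (p (k + 1) - p k) ^ θ = (p (k + 1) - p k) ^ (θ - 1) * (p (k + 1) - p k) := by
      rw [← Real.rpow_add_one' hx (by linarith)]; simp
    rw [this, mul_assoc]
    gcongr
    exact (hmesh k hk).le
  refine (norm_sum_le_of_le _ hterm).trans_lt ?_
  rw [← Finset.mul_sum, Finset.sum_range_sub, hp0, hpm, sub_zero]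
  exact hδε

/-- A path whose increments are of order larger than one is constant. -/
theorem eq_of_norm_sub_le_rpow {E : Type*} [NormedAddCommGroup E] {T K θ : ℝ} {D : ℝ → E}
    (hK : 0 ≤ K) (hθ : 1 < θ)
    (hD : ∀ s ∈ Icc 0 T, ∀ t ∈ Icc 0 T, s ≤ t → ‖D t - D s‖ ≤ K * (t - s) ^ θ)
    {t : ℝ} (ht : t ∈ Icc 0 T) : D t = D 0 := by
  -- The zero germ approximates `D`, so `D t - D 0` is a limit of zero sums; a single fine uniform
  -- partition then gives the contradiction.
  have hI := hasMeshLimit_of_norm_sub_le (T := T) (Ξ := fun _ _ => (0 : E))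
    (I := fun t => D t - D 0) hK hθ (sub_self _)
    (fun s hs t ht hst => by simpa using hD s hs t ht hst) ht
  by_contra hne
  obtain ⟨δ, hδ, h⟩ := hI ‖D t - D 0‖ (norm_pos_iff.2 (sub_ne_zero.2 hne))
  obtain ⟨m, hm⟩ := exists_nat_gt (t / δ)
  have hm0 : (0 : ℝ) < m := (div_nonneg ht.1 hδ.le).trans_lt hm
  have := h m (fun k => k * (t / m)) (monotone_grid (div_nonneg ht.1 hm0.le)) (by simp)
    (by field_simp) (fun k _ => by
      push_cast
      rw [add_mul, add_sub_cancel_left, one_mul, div_lt_iff₀ hm0]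
      rw [div_lt_iff₀ hδ] at hm
      linarith)
  simp [norm_sub_rev] at this

-- Uniform Taylor estimates on compact convex sets

theorem exists_norm_le_on_compact {V W : Type*} [TopologicalSpace V] [SeminormedAddCommGroup W]
    {f : V → W} {S : Set V} (hf : Continuous f) (hS : IsCompact S) :
    ∃ C, 0 ≤ C ∧ ∀ x ∈ S, ‖f x‖ ≤ C := by
  obtain ⟨C, hC⟩ := hS.exists_bound_of_continuousOn hf.continuousOn
  exact ⟨max C 0, le_max_right _ _, fun x hx => (hC x hx).trans (le_max_left _ _)⟩

section Taylor

variable {V W : Type*} [NormedAddCommGroup V] [NormedSpace ℝ V] [NormedAddCommGroup W]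
  [NormedSpace ℝ W] {f : V → W} {S : Set V}

theorem exists_lipschitz_bound (hf : ContDiff ℝ 1 f) (hS : IsCompact S) (hc : Convex ℝ S) :
    ∃ C, 0 ≤ C ∧ ∀ x ∈ S, ∀ y ∈ S, ‖f y - f x‖ ≤ C * ‖y - x‖ := by
  obtain ⟨C, hC0, hC⟩ := exists_norm_le_on_compact (hf.continuous_fderiv one_ne_zero) hS
  exact ⟨C, hC0, fun x hx y hy => hc.norm_image_sub_le_of_norm_fderiv_le
    (fun z _ => hf.differentiable one_ne_zero z) hC hx hy⟩

theorem exists_taylor_bound_one (hf : ContDiff ℝ 2 f) (hS : IsCompact S) (hc : Convex ℝ S) :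
    ∃ C, 0 ≤ C ∧ ∀ x ∈ S, ∀ y ∈ S, ‖f y - f x - fderiv ℝ f x (y - x)‖ ≤ C * ‖y - x‖ ^ 2 := by
  obtain ⟨C, hC0, hC⟩ := exists_lipschitz_bound (hf.fderiv_right (m := 1) (by norm_num)) hS hc
  refine ⟨C, hC0, fun x hx y hy => ?_⟩
  -- Intersecting with the ball keeps the set convex and bounds the variation of the derivative by
  -- `C * ‖y - x‖`.
  have := (hc.inter (convex_closedBall x ‖y - x‖)).norm_image_sub_le_of_norm_fderiv_le'
    (𝕜 := ℝ) (f := f) (φ := fderiv ℝ f x) (C := C * ‖y - x‖)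
    (fun z _ => hf.differentiable two_ne_zero z)
    (fun z hz => (hC x hx z hz.1).trans
      (mul_le_mul_of_nonneg_left (mem_closedBall_iff_norm.1 hz.2) hC0))
    ⟨hx, by simp⟩ ⟨hy, by simp [dist_eq_norm]⟩
  rwa [mul_assoc, ← sq] at this

theorem exists_taylor_bound_two (hf : ContDiff ℝ 3 f) (hS : IsCompact S) (hc : Convex ℝ S) :
    ∃ C, 0 ≤ C ∧ ∀ x ∈ S, ∀ y ∈ S, ‖f y - f x - fderiv ℝ f x (y - x)
      - (1 / 2 : ℝ) • fderiv ℝ (fderiv ℝ f) x (y - x) (y - x)‖ ≤ C * ‖y - x‖ ^ 3 := by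
  obtain ⟨C, hC0, hC⟩ := exists_taylor_bound_one (hf.fderiv_right (m := 2) (by norm_num)) hS hc
  refine ⟨C, hC0, fun x hx y hy => ?_⟩
  set B := fderiv ℝ (fderiv ℝ f) x with hB
  have hsymm : ∀ v w, B v w = B w v := fun v w =>
    (hf.contDiffAt.isSymmSndFDerivAt (by simp; norm_num)) v w
  -- With the quadratic term removed, the derivative differs from its value at `x` by the
  -- first-order Taylor remainder of `fderiv ℝ f`. Symmetry of `B` absorbs the factor `1 / 2`.
  have hd : ∀ z, HasFDerivAt (fun z => f z - (1 / 2 : ℝ) • B (z - x) (z - x))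
      (fderiv ℝ f z - B (z - x)) z := by
    intro z
    have h1 : HasFDerivAt f (fderiv ℝ f z) z := (hf.differentiable three_ne_zero z).hasFDerivAt
    have h2 : HasFDerivAt (fun z => z - x) (ContinuousLinearMap.id ℝ V) z :=
      (hasFDerivAt_id z).sub_const x
    have h3 := (B.hasFDerivAt.comp z h2).clm_apply h2
    refine (h1.sub (h3.const_smul (1 / 2 : ℝ))).congr_fderiv ?_
    ext v
    simp [hsymm v z, hsymm v x]
    module
  have := (hc.inter (convex_closedBall x ‖y - x‖)).norm_image_sub_le_of_norm_hasFDerivWithin_le'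
    (𝕜 := ℝ) (φ := fderiv ℝ f x) (C := C * ‖y - x‖ ^ 2)
    (fun z _ => (hd z).hasFDerivWithinAt)
    (fun z hz => by
      rw [sub_right_comm]
      exact (hC x hx z hz.1).trans (mul_le_mul_of_nonneg_left
        (pow_le_pow_left₀ (norm_nonneg _) (mem_closedBall_iff_norm.1 hz.2) 2) hC0))
    ⟨hx, by simp⟩ ⟨hy, by simp [dist_eq_norm]⟩
  rw [mul_assoc, ← pow_succ] at this
  convert this using 2
  simp only [sub_self, map_zero, smul_zero, sub_zero]
  abel

end Taylor

-- Differentials in coordinates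

section PartialDerivatives

variable {d : ℕ} {E : Type*} [NormedAddCommGroup E] [NormedSpace ℝ E]
  {G : EuclideanSpace ℝ (Fin d) → E}

theorem contDiff_partialD (hG : ContDiff ℝ ∞ G) (i : Fin d) : ContDiff ℝ ∞ (partialD i G) :=
  (hG.fderiv_right (m := ∞) (by simp)).clm_apply contDiff_const

theorem clm_apply_eq_sum (L : EuclideanSpace ℝ (Fin d) →L[ℝ] E) (v : EuclideanSpace ℝ (Fin d)) :
    L v = ∑ i, v i • L (EuclideanSpace.single i 1) := by
  conv_lhs => rw [← (EuclideanSpace.basisFun (Fin d) ℝ).sum_repr v]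
  simp

theorem fderiv_apply_eq_sum_partialD (y v : EuclideanSpace ℝ (Fin d)) :
    fderiv ℝ G y v = ∑ i, v i • partialD i G y :=
  clm_apply_eq_sum _ v

theorem partialD_partialD (hG : ContDiff ℝ ∞ G) (i j : Fin d) (y : EuclideanSpace ℝ (Fin d)) :
    partialD i (partialD j G) y =
      fderiv ℝ (fderiv ℝ G) y (EuclideanSpace.single i 1) (EuclideanSpace.single j 1) := by
  have h : DifferentiableAt ℝ (fderiv ℝ G) y :=
    ((hG.fderiv_right (m := ∞) (by simp)).differentiable (by simp)) y
  have h2 : HasFDerivAt (partialD j G) _ y := h.hasFDerivAt.clm_apply (hasFDerivAt_const _ _)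
  rw [partialD, h2.fderiv]
  simp

theorem partialD_comm (hG : ContDiff ℝ ∞ G) (i j : Fin d) (y : EuclideanSpace ℝ (Fin d)) :
    partialD i (partialD j G) y = partialD j (partialD i G) y := by
  rw [partialD_partialD hG, partialD_partialD hG]
  exact (hG.contDiffAt.isSymmSndFDerivAt (by simp; exact WithTop.coe_le_coe.2 le_top)) _ _

theorem fderiv_fderiv_apply_eq_sum (hG : ContDiff ℝ ∞ G) (y v : EuclideanSpace ℝ (Fin d)) :
    fderiv ℝ (fderiv ℝ G) y v v = ∑ i, ∑ j, (v i * v j) • partialD i (partialD j G) y := by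
  rw [clm_apply_eq_sum (fderiv ℝ (fderiv ℝ G) y) v, sum_apply]
  refine Finset.sum_congr rfl fun i _ => ?_
  rw [smul_apply, clm_apply_eq_sum, Finset.smul_sum]
  exact Finset.sum_congr rfl fun j _ => by rw [partialD_partialD hG, smul_smul]

end PartialDerivatives

-- Coproduct and shuffle on small forests

section Combinatorics

variable {A : Type*}

@[simp] theorem size_nil : size ([] : Forest A) = 0 := by simp [size, forestWeight]

theorem size_cons (a : A) (σ τ : Forest A) : size (.node a σ :: τ) = 1 + size σ + size τ := by
  simp [size, forestWeight, PTree.weight]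

@[simp] theorem size_dot (a : A) : size [dot a] = 1 := by simp [size_cons]

@[simp] theorem size_ladder (a b : A) : size [.node a [dot b]] = 2 := by simp [size_cons]

theorem size_eq_zero {τ : Forest A} (h : size τ = 0) : τ = [] := by
  match τ with
  | [] => rfl
  | .node a σ :: τ => rw [size_cons] at h; omega

theorem size_eq_one {τ : Forest A} (h : size τ = 1) : ∃ a, τ = [dot a] := by
  match τ with
  | [] => simp at h
  | .node a σ :: τ =>
    rw [size_cons] at h
    exact ⟨a, by rw [size_eq_zero (τ := σ) (by omega), size_eq_zero (τ := τ) (by omega)]⟩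

theorem coprod_dot (a : A) : coprod [dot a] = [([dot a], []), ([], [dot a])] := by
  have := coprod_concat [] [] a
  simpa [coprod_nil, shuffleConcat, shuffle] using this

theorem coprod_ladder (a b : A) : coprod [PTree.node a [dot b]] =
    [([.node a [dot b]], []), ([dot b], [dot a]), ([], [.node a [dot b]])] := by
  have := coprod_concat [] [dot b] a
  simpa [coprod_nil, coprod_dot, shuffleConcat, shuffle] using this

theorem star_nil (ξ η : Forest A → ℝ) : star ξ η [] = ξ [] * η [] := by
  simp [star, coprod_nil]

theorem star_dot (ξ η : Forest A → ℝ) (a : A) :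
    star ξ η [dot a] = ξ [dot a] * η [] + ξ [] * η [dot a] := by
  simp [star, coprod_dot]

theorem star_ladder (ξ η : Forest A → ℝ) (a b : A) :
    star ξ η [.node a [dot b]] =
      ξ [.node a [dot b]] * η [] + ξ [dot b] * η [dot a] + ξ [] * η [.node a [dot b]] := by
  simp [star, coprod_ladder, add_assoc]

theorem shufflePairing_dot_dot (ξ : Forest A → ℝ) (a b : A) :
    shufflePairing ξ [dot a] [dot b] = ξ [dot a, dot b] + ξ [dot b, dot a] := by
  simp [shufflePairing, shuffle]

end Combinatorics

theorem level_eq_two {α : ℝ} (hα₁ : 1 / 3 < α) (hα₂ : α ≤ 1 / 2) : level α = 2 := by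
  have h0 : 0 < α := by linarith
  rw [level, Nat.floor_eq_iff (by positivity)]
  constructor
  · rw [le_div_iff₀ h0]; push_cast; linarith
  · rw [div_lt_iff₀ h0]; push_cast; linarith

-- Calculus of orders

/-- The two-parameter map `f` is of order `|t - s| ^ θ`, uniformly in `s, t ∈ [0, T]`. -/
def HasOrder {E : Type*} [Norm E] (T θ : ℝ) (f : ℝ → ℝ → E) : Prop :=
  ∃ C, 0 ≤ C ∧ ∀ s ∈ Icc 0 T, ∀ t ∈ Icc 0 T, ‖f s t‖ ≤ C * |t - s| ^ θ

namespace HasOrder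

variable {E : Type*} [NormedAddCommGroup E] {T θ : ℝ} {f g : ℝ → ℝ → E}

theorem of_bound {C : ℝ} (h : ∀ s ∈ Icc 0 T, ∀ t ∈ Icc 0 T, ‖f s t‖ ≤ C * |t - s| ^ θ) :
    HasOrder T θ f :=
  ⟨max C 0, le_max_right _ _, fun s hs t ht => (h s hs t ht).trans
    (mul_le_mul_of_nonneg_right (le_max_left _ _) (Real.rpow_nonneg (abs_nonneg _) _))⟩

theorem congr (hf : HasOrder T θ f) (h : ∀ s ∈ Icc 0 T, ∀ t ∈ Icc 0 T, g s t = f s t) :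
    HasOrder T θ g := by
  obtain ⟨C, hC, hf⟩ := hf
  exact ⟨C, hC, fun s hs t ht => by rw [h s hs t ht]; exact hf s hs t ht⟩

theorem sub (hf : HasOrder T θ f) (hg : HasOrder T θ g) :
    HasOrder T θ fun s t => f s t - g s t := by
  obtain ⟨C, hC, hf⟩ := hf
  obtain ⟨D, hD, hg⟩ := hg
  refine ⟨C + D, add_nonneg hC hD, fun s hs t ht => ?_⟩
  rw [add_mul]
  exact (norm_sub_le _ _).trans (add_le_add (hf s hs t ht) (hg s hs t ht))

theorem sum {ι : Type*} (S : Finset ι) {f : ι → ℝ → ℝ → E} (h : ∀ i, HasOrder T θ (f i)) :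
    HasOrder T θ fun s t => ∑ i ∈ S, f i s t := by
  choose C hC hf using h
  refine ⟨∑ i ∈ S, C i, Finset.sum_nonneg fun i _ => hC i, fun s hs t ht => ?_⟩
  rw [Finset.sum_mul]
  exact norm_sum_le_of_le _ fun i _ => hf i s hs t ht

theorem smul_bounded [NormedSpace ℝ E] {c : ℝ → ℝ → ℝ} {g : ℝ → E} {D : ℝ} (hc : HasOrder T θ c)
    (hD : 0 ≤ D) (hg : ∀ s ∈ Icc 0 T, ‖g s‖ ≤ D) : HasOrder T θ fun s t => c s t • g s := by
  obtain ⟨C, hC, hc⟩ := hc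
  refine ⟨C * D, mul_nonneg hC hD, fun s hs t ht => ?_⟩
  rw [norm_smul, mul_right_comm]
  exact mul_le_mul (hc s hs t ht) (hg s hs) (norm_nonneg _) (by positivity)

end HasOrder

-- Rough path coefficients at level two

namespace IsRoughPath

variable {A : Type*} {α T : ℝ} {X : ℝ → ℝ → Forest A → ℝ}

theorem chen_dot (hX : IsRoughPath α T X) (hα : level α = 2) {s u t : ℝ} (hs : s ∈ Icc 0 T)
    (hu : u ∈ Icc 0 T) (ht : t ∈ Icc 0 T) (a : A) :
    X s t [dot a] = X s u [dot a] + X u t [dot a] := by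
  rw [← hX.chen s hs u hu t ht [dot a] (by simp [hα]), star_dot, hX.unit s hs u hu,
    hX.unit u hu t ht]
  ring

theorem chen_ladder (hX : IsRoughPath α T X) (hα : level α = 2) {s u t : ℝ} (hs : s ∈ Icc 0 T)
    (hu : u ∈ Icc 0 T) (ht : t ∈ Icc 0 T) (a b : A) :
    X s t [.node a [dot b]] =
      X s u [.node a [dot b]] + X s u [dot b] * X u t [dot a] + X u t [.node a [dot b]] := by
  rw [← hX.chen s hs u hu t ht [.node a [dot b]] (by simp [hα]), star_ladder,
    hX.unit s hs u hu, hX.unit u hu t ht]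
  ring

/-- The Hölder bounds are assumed only for `s ≠ t`; on the diagonal Chen's relation forces the
coefficient to vanish. -/
theorem dot_self (hX : IsRoughPath α T X) (hα : level α = 2) {t : ℝ} (ht : t ∈ Icc 0 T) (a : A) :
    X t t [dot a] = 0 := by
  linarith [hX.chen_dot hα ht ht ht a]

theorem ladder_self (hX : IsRoughPath α T X) (hα : level α = 2) {t : ℝ} (ht : t ∈ Icc 0 T)
    (a b : A) : X t t [.node a [dot b]] = 0 := by
  have := hX.chen_ladder hα ht ht ht a b
  rw [hX.dot_self hα ht] at this
  linarith

theorem hasOrder_dot (hX : IsRoughPath α T X) (hα : level α = 2) (a : A) :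
    HasOrder T α fun s t => X s t [dot a] := by
  obtain ⟨C, hC⟩ := hX.holder [dot a] (by simp [hα])
  refine .of_bound (C := max C 0) fun s hs t ht => ?_
  rcases eq_or_ne s t with rfl | hst
  · simp only [hX.dot_self hα hs, norm_zero]; positivity
  · refine (hC s hs t ht hst).trans ?_
    simp only [size_dot, Nat.cast_one, one_mul]
    gcongr; exact le_max_left _ _

theorem hasOrder_ladder (hX : IsRoughPath α T X) (hα : level α = 2) (a b : A) :
    HasOrder T (2 * α) fun s t => X s t [.node a [dot b]] := by
  obtain ⟨C, hC⟩ := hX.holder [.node a [dot b]] (by simp [hα])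
  refine .of_bound (C := max C 0) fun s hs t ht => ?_
  rcases eq_or_ne s t with rfl | hst
  · simp only [hX.ladder_self hα hs, norm_zero]; positivity
  · refine (hC s hs t ht hst).trans ?_
    simp only [size_ladder, Nat.cast_ofNat]
    gcongr; exact le_max_left _ _

end IsRoughPath

-- Lifts of functions over either alphabet

section Lift

variable {A E : Type*} [NormedAddCommGroup E] [NormedSpace ℝ E] {d : ℕ}

/-- The path `G(X)` of truncation level two, its letters being read in the alphabet `A` by means
of `e`. -/
noncomputable def liftAlong (e : Fin d → A) (G : EuclideanSpace ℝ (Fin d) → E)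
    (x : ℝ → EuclideanSpace ℝ (Fin d)) (t : ℝ) : Forest A →₀ E :=
  Finsupp.single [] (G (x t)) + ∑ i, Finsupp.single [dot (e i)] (partialD i G (x t))

theorem lift_eq_liftAlong (G : EuclideanSpace ℝ (Fin d) → E) (x : ℝ → EuclideanSpace ℝ (Fin d)) :
    lift G x = liftAlong id G x := rfl

theorem extend_lift_eq_liftAlong (G : EuclideanSpace ℝ (Fin d) → E)
    (x : ℝ → EuclideanSpace ℝ (Fin d)) :
    extend (lift G x) = liftAlong (Sum.inl : Fin d → ExtLetter d) G x := by
  funext t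
  simp [extend, lift, liftAlong, Finsupp.mapDomain_add, Finsupp.mapDomain_finsetSum,
    Finsupp.mapDomain_single, forestRelabel, PTree.relabel]

/-- Germs and star pairings are both sums of this shape. Only additivity is used, so `e` need not be
injective. -/
theorem liftAlong_sum_smul (e : Fin d → A) (G : EuclideanSpace ℝ (Fin d) → E)
    (x : ℝ → EuclideanSpace ℝ (Fin d)) (t : ℝ) (c : Forest A → ℝ) :
    ((liftAlong e G x t).sum fun τ v => c τ • v) =
      c [] • G (x t) + ∑ i, c [dot (e i)] • partialD i G (x t) := by
  obtain ⟨f, hf⟩ : ∃ f : Forest A → E → E, f = fun τ v => c τ • v := ⟨_, rfl⟩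
  have h0 : ∀ τ, f τ 0 = 0 := fun τ => by simp [hf]
  have ha : ∀ τ (v w : E), f τ (v + w) = f τ v + f τ w := fun τ v w => by simp [hf]
  rw [← hf, liftAlong, Finsupp.sum_add_index' h0 ha, Finsupp.sum_single_index (h0 _),
    ← Finsupp.sum_finsetSum_index h0 ha]
  rw [Finset.sum_congr rfl fun i _ => Finsupp.sum_single_index (h0 [dot (e i)]), hf]

theorem liftAlong_apply_nil (e : Fin d → A) (G : EuclideanSpace ℝ (Fin d) → E)
    (x : ℝ → EuclideanSpace ℝ (Fin d)) (t : ℝ) : liftAlong e G x t [] = G (x t) := by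
  simp [liftAlong]

theorem liftAlong_apply_eq_zero (e : Fin d → A) (G : EuclideanSpace ℝ (Fin d) → E)
    (x : ℝ → EuclideanSpace ℝ (Fin d)) (t : ℝ) {τ : Forest A} (hτ : 2 ≤ size τ) :
    liftAlong e G x t τ = 0 := by
  have h0 : [] ≠ τ := by rintro rfl; simp at hτ
  have h1 : ∀ a, [dot a] ≠ τ := by rintro a rfl; simp at hτ
  simp [liftAlong, h0, h1]

open Classical in
theorem liftAlong_apply_dot (e : Fin d → A) (G : EuclideanSpace ℝ (Fin d) → E)
    (x : ℝ → EuclideanSpace ℝ (Fin d)) (t : ℝ) (a : A) :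
    liftAlong e G x t [dot a] = ∑ i, if e i = a then partialD i G (x t) else 0 := by
  simp [liftAlong, Finsupp.single_apply]

theorem germ_liftAlong (X : ℝ → ℝ → Forest A → ℝ) (e : Fin d → A)
    (G : EuclideanSpace ℝ (Fin d) → E) (x : ℝ → EuclideanSpace ℝ (Fin d)) (a : A) (s t : ℝ) :
    germ X (liftAlong e G x) a s t =
      X s t [dot a] • G (x s) + ∑ k, X s t [.node a [dot (e k)]] • partialD k G (x s) :=
  liftAlong_sum_smul e G x s fun τ => X s t [.node a τ]

theorem starPairing_nil_liftAlong (ξ : Forest A → ℝ) (hξ : ξ [] = 1) (e : Fin d → A)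
    (G : EuclideanSpace ℝ (Fin d) → E) (x : ℝ → EuclideanSpace ℝ (Fin d)) (t : ℝ) :
    starPairing ξ [] (liftAlong e G x t) =
      G (x t) + ∑ k, ξ [dot (e k)] • partialD k G (x t) := by
  refine (liftAlong_sum_smul e G x t (star ξ (basisElt []))).trans ?_
  simp [star_nil, star_dot, basisElt, hξ]

theorem starPairing_dot_liftAlong (ξ : Forest A → ℝ) (hξ : ξ [] = 1) (e : Fin d → A)
    (G : EuclideanSpace ℝ (Fin d) → E) (x : ℝ → EuclideanSpace ℝ (Fin d)) (t : ℝ) (a : A) :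
    starPairing ξ [dot a] (liftAlong e G x t) = liftAlong e G x t [dot a] := by
  refine (liftAlong_sum_smul e G x t (star ξ (basisElt [dot a]))).trans ?_
  simp [star_nil, star_dot, basisElt, hξ, liftAlong_apply_dot]
  refine Finset.sum_congr rfl fun i _ => ?_
  split_ifs <;> simp_all

end Lift

-- Taylor remainders along a Hölder path

namespace HasOrder

variable {d : ℕ} {E : Type*} [NormedAddCommGroup E] [NormedSpace ℝ E] {T α : ℝ}
  {x : ℝ → EuclideanSpace ℝ (Fin d)} {G : EuclideanSpace ℝ (Fin d) → E}

theorem of_norm_le_pow {E : Type*} [NormedAddCommGroup E] {f : ℝ → ℝ → E} (hx : HasOrder T α fun s t => x t - x s) {K : ℝ}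
    (hK : 0 ≤ K) (k : ℕ)
    (hf : ∀ s ∈ Icc 0 T, ∀ t ∈ Icc 0 T, ‖f s t‖ ≤ K * ‖x t - x s‖ ^ k) :
    HasOrder T (k * α) f := by
  obtain ⟨C, hC, hx⟩ := hx
  refine ⟨K * C ^ k, by positivity, fun s hs t ht => (hf s hs t ht).trans ?_⟩
  rw [mul_comm (k : ℝ), Real.rpow_mul (abs_nonneg _), Real.rpow_natCast, mul_assoc, ← mul_pow]
  gcongr
  exact hx s hs t ht

/-- A Hölder path stays in a closed ball around its starting point, which is where the Taylor
constants are taken. -/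
theorem exists_compact_convex (hx : HasOrder T α fun s t => x t - x s) (hT : 0 ≤ T)
    (hα : 0 ≤ α) : ∃ S, IsCompact S ∧ Convex ℝ S ∧ ∀ t ∈ Icc 0 T, x t ∈ S := by
  obtain ⟨C, hC, hx⟩ := hx
  refine ⟨Metric.closedBall (x 0) (C * T ^ α), isCompact_closedBall _ _, convex_closedBall _ _,
    fun t ht => ?_⟩
  rw [mem_closedBall_iff_norm]
  refine (hx 0 ⟨le_rfl, hT⟩ t ht).trans ?_
  rw [sub_zero, abs_of_nonneg ht.1]
  gcongr
  · exact ht.1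
  · exact ht.2

theorem exists_bound_comp (hx : HasOrder T α fun s t => x t - x s) (hT : 0 ≤ T) (hα : 0 ≤ α)
    (hG : ContDiff ℝ ∞ G) : ∃ D, 0 ≤ D ∧ ∀ t ∈ Icc 0 T, ‖G (x t)‖ ≤ D := by
  obtain ⟨S, hS, -, hxS⟩ := hx.exists_compact_convex hT hα
  obtain ⟨D, hD, h⟩ := exists_norm_le_on_compact hG.continuous hS
  exact ⟨D, hD, fun t ht => h _ (hxS t ht)⟩

theorem comp_sub (hx : HasOrder T α fun s t => x t - x s) (hT : 0 ≤ T) (hα : 0 ≤ α)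
    (hG : ContDiff ℝ ∞ G) : HasOrder T α fun s t => G (x t) - G (x s) := by
  obtain ⟨S, hS, hc, hxS⟩ := hx.exists_compact_convex hT hα
  obtain ⟨D, hD, h⟩ := exists_lipschitz_bound (hG.of_le (WithTop.coe_le_coe.2 le_top)) hS hc
  simpa using hx.of_norm_le_pow hD 1 fun s hs t ht => by
    simpa using h _ (hxS s hs) _ (hxS t ht)

theorem taylor_one (hx : HasOrder T α fun s t => x t - x s) (hT : 0 ≤ T) (hα : 0 ≤ α)
    (hG : ContDiff ℝ ∞ G) : HasOrder T (2 * α) fun s t =>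
      G (x t) - G (x s) - ∑ i, (x t i - x s i) • partialD i G (x s) := by
  obtain ⟨S, hS, hc, hxS⟩ := hx.exists_compact_convex hT hα
  obtain ⟨D, hD, h⟩ := exists_taylor_bound_one (hG.of_le (WithTop.coe_le_coe.2 le_top)) hS hc
  exact hx.of_norm_le_pow hD 2 fun s hs t ht => by
    simpa only [fderiv_apply_eq_sum_partialD, PiLp.sub_apply] using h _ (hxS s hs) _ (hxS t ht)

theorem taylor_two (hx : HasOrder T α fun s t => x t - x s) (hT : 0 ≤ T) (hα : 0 ≤ α)
    (hG : ContDiff ℝ ∞ G) : HasOrder T (3 * α) fun s t =>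
      G (x t) - G (x s) - ∑ i, (x t i - x s i) • partialD i G (x s)
        - (1 / 2 : ℝ) • ∑ i, ∑ j,
          ((x t i - x s i) * (x t j - x s j)) • partialD i (partialD j G) (x s) := by
  obtain ⟨S, hS, hc, hxS⟩ := hx.exists_compact_convex hT hα
  obtain ⟨D, hD, h⟩ := exists_taylor_bound_two (hG.of_le (WithTop.coe_le_coe.2 le_top)) hS hc
  exact hx.of_norm_le_pow hD 3 fun s hs t ht => by
    simpa only [fderiv_fderiv_apply_eq_sum hG, fderiv_apply_eq_sum_partialD (G := G),
      PiLp.sub_apply]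
      using h _ (hxS s hs) _ (hxS t ht)

/-- Bounds one term of an additivity defect. The times are unordered, so `|u - s| + |t - u|`
replaces `|t - s|`. -/
theorem smul_consecutive {β γ : ℝ} (hβ : 0 ≤ β) (hγ : 0 ≤ γ) {f : ℝ → ℝ → E} {c : ℝ → ℝ → ℝ}
    (hf : HasOrder T β f) (hc : HasOrder T γ c) : ∃ C, 0 ≤ C ∧ ∀ s ∈ Icc 0 T, ∀ u ∈ Icc 0 T,
      ∀ t ∈ Icc 0 T, ‖c u t • f s u‖ ≤ C * (|u - s| + |t - u|) ^ (β + γ) := by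
  obtain ⟨C, hC, hf⟩ := hf
  obtain ⟨D, hD, hc⟩ := hc
  refine ⟨D * C, mul_nonneg hD hC, fun s hs u hu t ht => ?_⟩
  have h0 : 0 ≤ |u - s| + |t - u| := by positivity
  have h1 : |u - s| ^ β ≤ (|u - s| + |t - u|) ^ β :=
    Real.rpow_le_rpow (abs_nonneg _) (by linarith [abs_nonneg (t - u)]) hβ
  have h2 : |t - u| ^ γ ≤ (|u - s| + |t - u|) ^ γ :=
    Real.rpow_le_rpow (abs_nonneg _) (by linarith [abs_nonneg (u - s)]) hγ
  rw [norm_smul, Real.rpow_add_of_nonneg h0 hβ hγ]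
  calc ‖c u t‖ * ‖f s u‖ ≤ (D * |t - u| ^ γ) * (C * |u - s| ^ β) :=
        mul_le_mul (hc u hu t ht) (hf s hs u hu) (norm_nonneg _) (by positivity)
    _ ≤ (D * (|u - s| + |t - u|) ^ γ) * (C * (|u - s| + |t - u|) ^ β) := by gcongr
    _ = _ := by ring

end HasOrder

-- Existence of the rough integrals

namespace IsRoughPath

variable {A E : Type*} {d : ℕ} [NormedAddCommGroup E] [NormedSpace ℝ E] {T α : ℝ}
  {X : ℝ → ℝ → Forest A → ℝ} {e : Fin d → A} {x : ℝ → EuclideanSpace ℝ (Fin d)}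
  {G : EuclideanSpace ℝ (Fin d) → E}

theorem hasOrder_path (hX : IsRoughPath α T X) (hα : level α = 2)
    (hx : ∀ s ∈ Icc 0 T, ∀ t ∈ Icc 0 T, ∀ i, X s t [dot (e i)] = x t i - x s i) :
    HasOrder T α fun s t => x t - x s := by
  refine (HasOrder.sum Finset.univ (f := fun i s t =>
    X s t [dot (e i)] • EuclideanSpace.single i (1 : ℝ)) fun i =>
    (hX.hasOrder_dot hα (e i)).smul_bounded zero_le_one (by simp)).congr fun s hs t ht => ?_
  simp only [hx s hs t ht]
  exact clm_apply_eq_sum (ContinuousLinearMap.id ℝ _) (x t - x s)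

/-- On the empty forest the remainder is the first-order Taylor remainder of `G`; on a single vertex
it is a plain increment of first derivatives. -/
theorem isControlled_liftAlong (hX : IsRoughPath α T X) (hα : level α = 2) (hα0 : 0 ≤ α)
    (hT : 0 ≤ T) (hx : ∀ s ∈ Icc 0 T, ∀ t ∈ Icc 0 T, ∀ i, X s t [dot (e i)] = x t i - x s i)
    (hG : ContDiff ℝ ∞ G) : IsControlled α T X (liftAlong e G x) where
  truncated t _ τ hτ := liftAlong_apply_eq_zero e G x t (hα ▸ hτ)
  remainder τ hτ := by
    have hpath := hX.hasOrder_path hα hx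
    rw [hα] at hτ
    simp only [hα]
    rcases (show size τ = 0 ∨ size τ = 1 by omega) with h | h
    · obtain rfl := size_eq_zero h
      obtain ⟨C, -, hC⟩ := hpath.taylor_one hT hα0 hG
      refine ⟨C, fun s hs t ht => ?_⟩
      rw [liftAlong_apply_nil, starPairing_nil_liftAlong _ (hX.unit s hs t ht), ← sub_sub]
      simpa [hx s hs t ht] using hC s hs t ht
    · obtain ⟨a, rfl⟩ := size_eq_one h
      classical
      have hdot : HasOrder T α fun s t =>
          ∑ i, if e i = a then partialD i G (x t) - partialD i G (x s) else 0 := by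
        refine HasOrder.sum _ fun i => ?_
        split_ifs
        · exact hpath.comp_sub hT hα0 (contDiff_partialD hG i)
        · exact ⟨0, le_rfl, by simp⟩
      obtain ⟨C, -, hC⟩ := hdot
      refine ⟨C, fun s hs t ht => ?_⟩
      rw [starPairing_dot_liftAlong _ (hX.unit s hs t ht), liftAlong_apply_dot,
        liftAlong_apply_dot, ← Finset.sum_sub_distrib, size_dot]
      refine Eq.trans_le ?_ ((hC s hs t ht).trans_eq ?_)
      · congr 1
        refine Finset.sum_congr rfl fun i _ => ?_
        split_ifs <;> simp
      · norm_num

theorem isAlmostAdditive_germ (hX : IsRoughPath α T X) (hα : level α = 2) (hα0 : 0 ≤ α)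
    (hT : 0 ≤ T) (hx : ∀ s ∈ Icc 0 T, ∀ t ∈ Icc 0 T, ∀ i, X s t [dot (e i)] = x t i - x s i)
    (hG : ContDiff ℝ ∞ G) (a : A) :
    ∃ C, 0 ≤ C ∧ IsAlmostAdditive T C (3 * α) (germ X (liftAlong e G x) a) := by
  have hpath := hX.hasOrder_path hα hx
  obtain ⟨C, hC0, hC⟩ := HasOrder.smul_consecutive (by positivity) hα0
    (hpath.taylor_one hT hα0 hG) (hX.hasOrder_dot hα a)
  choose D hD0 hD using fun k => HasOrder.smul_consecutive hα0 (by positivity)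
    (hpath.comp_sub hT hα0 (contDiff_partialD hG k)) (hX.hasOrder_ladder hα a (e k))
  refine ⟨C + ∑ k, D k, add_nonneg hC0 (Finset.sum_nonneg fun k _ => hD0 k),
    fun s hs u hu t ht => ?_⟩
  -- Chen's cross term `X_{s,u}(•_k) X_{u,t}(•_a)` supplies the linear term that completes the
  -- Taylor remainder of `G`.
  have key : germ X (liftAlong e G x) a s t - germ X (liftAlong e G x) a s u
      - germ X (liftAlong e G x) a u t =
      -(X u t [dot a] • (G (x u) - G (x s) - ∑ i, (x u i - x s i) • partialD i G (x s)))
      - ∑ k, X u t [.node a [dot (e k)]] • (partialD k G (x u) - partialD k G (x s)) := by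
    simp only [germ_liftAlong, hX.chen_dot hα hs hu ht, hX.chen_ladder hα hs hu ht,
      ← hx s hs u hu, smul_sub, Finset.smul_sum, add_smul, Finset.sum_add_distrib,
      Finset.sum_sub_distrib, smul_smul, mul_comm (X u t [dot a])]
    abel
  rw [key, add_mul, Finset.sum_mul]
  refine (norm_sub_le _ _).trans (add_le_add ?_ (norm_sum_le_of_le _ fun k _ => ?_))
  · rw [norm_neg]
    rw [show 3 * α = 2 * α + α by ring]
    exact hC s hs u hu t ht
  · rw [show 3 * α = α + 2 * α by ring]
    exact hD k s hs u hu t ht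

theorem exists_isRoughIntegral [CompleteSpace E] (hX : IsRoughPath α T X) (hα : level α = 2)
    (hα0 : 1 / 3 < α) (hT : 0 ≤ T)
    (hx : ∀ s ∈ Icc 0 T, ∀ t ∈ Icc 0 T, ∀ i, X s t [dot (e i)] = x t i - x s i)
    (hG : ContDiff ℝ ∞ G) (a : A) : ∃ I, IsRoughIntegral α T X (liftAlong e G x) a I := by
  have hα1 : 0 ≤ α := by linarith
  have hθ : 1 < 3 * α := by linarith
  obtain ⟨C, hC, hΞ⟩ := hX.isAlmostAdditive_germ hα hα1 hT hx hG a
  obtain ⟨I, hI0, hI⟩ := hΞ.exists_path hT hC hθ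
  have hK := sewingConst_nonneg hC hθ
  refine ⟨I, hX.isControlled_liftAlong hα hα1 hT hx hG, ?_, fun t ht =>
    hasMeshLimit_of_norm_sub_le hK hθ hI0 hI ht⟩
  have hexp : ((level α : ℝ) + 1) * α = 3 * α := by rw [hα]; norm_num
  rw [hexp]
  generalize germ X (liftAlong e G x) a = Ξ at *
  refine ⟨sewingConst C (3 * α) + C * 2 ^ (3 * α), fun s hs t ht => ?_⟩
  rcases le_total s t with hst | hts
  · refine (hI s hs t ht hst).trans ?_
    rw [abs_of_nonneg (sub_nonneg.2 hst)]
    have : 0 ≤ (t - s) ^ (3 * α) := Real.rpow_nonneg (sub_nonneg.2 hst) _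
    gcongr
    exact le_add_of_nonneg_right (by positivity)
  -- Sewing covers only `s ≤ t`. For reversed times, the defect on `s, t, s` compares `Ξ s t` with
  -- `-Ξ t s`, whence the extra `C * 2 ^ (3 * α)`.
  · have h1 := hI t ht s hs hts
    have h2 := hΞ s hs t ht s hs
    rw [hΞ.self_eq_zero hθ hs, abs_sub_comm s t, ← two_mul,
      Real.mul_rpow (by norm_num) (abs_nonneg _), ← mul_assoc] at h2
    rw [← abs_of_nonneg (sub_nonneg.2 hts), abs_sub_comm s t] at h1
    have : I t - I s - Ξ s t = (0 - Ξ s t - Ξ t s) - (I s - I t - Ξ t s) := by abel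
    rw [this, add_mul, add_comm (_ * _)]
    exact (norm_sub_le _ _).trans (add_le_add h2 h1)

end IsRoughPath

-- The Itô formula

section Ito

variable {d : ℕ} {E : Type*} [NormedAddCommGroup E] [NormedSpace ℝ E] {T α : ℝ}
  {X : ℝ → ℝ → Forest (Fin d) → ℝ} {Xhat : ℝ → ℝ → Forest (ExtLetter d) → ℝ}
  {x : ℝ → EuclideanSpace ℝ (Fin d)} {F : EuclideanSpace ℝ (Fin d) → E}

theorem IsBracketExtension.dot_inl (h : IsBracketExtension α T X Xhat) (hXx : IsAbove T X x) :
    ∀ s ∈ Icc 0 T, ∀ t ∈ Icc 0 T, ∀ i, Xhat s t [dot (Sum.inl i)] = x t i - x s i := by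
  intro s hs t ht i
  rw [← hXx s hs t ht i, ← h.extends_path s hs t ht [dot i]]
  simp [forestRelabel, PTree.relabel]

/-- The weights add up to `2 + 1`. Counting vertices alone would give order `2 * α`, too weak to
discard these terms. -/
theorem IsBracketExtension.hasOrder_ladder_bracket (h : IsBracketExtension α T X Xhat)
    (hα : level α = 2) (p : Fin d × Fin d) (k : Fin d) :
    HasOrder T (3 * α) fun s t => Xhat s t [.node (Sum.inr p) [dot (Sum.inl k)]] := by
  obtain ⟨C, hC⟩ := h.homogeneous [.node (Sum.inr p) [dot (Sum.inl k)]] (by simp [hα])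
  refine .of_bound (C := max C 0) fun s hs t ht => ?_
  rcases eq_or_ne s t with rfl | hst
  · simp only [h.isRoughPath.ladder_self hα hs, norm_zero]; positivity
  · refine (hC s hs t ht hst).trans ?_
    simp only [forestWeight, PTree.weight, letterWeight]
    norm_num
    gcongr; exact le_max_left _ _

/-- The sum of the bracket terms and of the second-order terms of the first-order integrals is the
second-order term of the Taylor formula. -/
theorem sum_bracket_add_sum_ladder (hX : IsRoughPath α T X) (hα : level α = 2)
    (hXx : IsAbove T X x) (hF : ContDiff ℝ ∞ F) {s t : ℝ} (hs : s ∈ Icc 0 T) (ht : t ∈ Icc 0 T) :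
    ∑ i, ∑ k, X s t [.node i [dot k]] • partialD k (partialD i F) (x s)
      + ∑ i, ∑ j, bracket X i j s t • partialD i (partialD j F) (x s)
      = (1 / 2 : ℝ) • ∑ i, ∑ j,
          ((x t i - x s i) * (x t j - x s j)) • partialD i (partialD j F) (x s) := by
  have h1 : ∀ i j, (x t i - x s i) * (x t j - x s j) = X s t [dot i, dot j] + X s t [dot j, dot i] :=
    fun i j => by
      rw [← hXx s hs t ht, ← hXx s hs t ht, ← hX.shuffle s hs t ht _ _ (by simp [hα]),
        shufflePairing_dot_dot]
  -- Against the symmetric Hessian both orders of the word contribute equally, so half the shuffle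
  -- is one word.
  have h2 : ∑ i, ∑ j, X s t [dot i, dot j] • partialD i (partialD j F) (x s)
      = ∑ i, ∑ j, X s t [dot j, dot i] • partialD i (partialD j F) (x s) := by
    rw [Finset.sum_comm]
    exact Finset.sum_congr rfl fun j _ => Finset.sum_congr rfl fun i _ => by
      rw [partialD_comm hF i j]
  -- Puts the ladder terms in the form in which the brackets subtract them.
  have h3 : ∑ i, ∑ k, X s t [.node i [dot k]] • partialD k (partialD i F) (x s)
      = ∑ i, ∑ k, X s t [.node i [dot k]] • partialD i (partialD k F) (x s) :=
    Finset.sum_congr rfl fun i _ => Finset.sum_congr rfl fun k _ => by rw [partialD_comm hF i k]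
  simp only [h1, add_smul, Finset.sum_add_distrib, h2, h3, bracket, sub_smul,
    Finset.sum_sub_distrib]
  module

/-- The Itô formula at the level of germs: the error is the second-order Taylor remainder minus the
weight-three ladders. -/
theorem hasOrder_ito (hX : IsRoughPath α T X) (hα : level α = 2) (hα0 : 0 ≤ α) (hT : 0 ≤ T)
    (hXx : IsAbove T X x) (hXhat : IsBracketExtension α T X Xhat) (hF : ContDiff ℝ ∞ F) :
    HasOrder T (3 * α) fun s t => F (x t) - F (x s)
      - ∑ i, germ X (liftAlong id (partialD i F) x) i s t
      - ∑ i, ∑ j, germ Xhat (liftAlong Sum.inl (partialD i (partialD j F)) x)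
          (Sum.inr (i, j)) s t := by
  have hpath := hX.hasOrder_path (e := id) hα hXx
  have hrem : HasOrder T (3 * α) fun s t => ∑ i, ∑ j, ∑ k,
      Xhat s t [.node (Sum.inr (i, j)) [dot (Sum.inl k)]]
        • partialD k (partialD i (partialD j F)) (x s) := by
    refine .sum _ fun i => .sum _ fun j => .sum _ fun k => ?_
    obtain ⟨D, hD, hb⟩ := hpath.exists_bound_comp hT hα0
      (contDiff_partialD (contDiff_partialD (contDiff_partialD hF j) i) k)
    exact (hXhat.hasOrder_ladder_bracket hα (i, j) k).smul_bounded hD hb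
  refine ((hpath.taylor_two hT hα0 hF).sub hrem).congr fun s hs t ht => ?_
  rw [← sum_bracket_add_sum_ladder hX hα hXx hF hs ht]
  simp only [germ_liftAlong, hXx s hs t ht, hXhat.bracket_path s hs t ht, Finset.sum_add_distrib,
    id_eq]
  abel

theorem ito_formula (hα : level α = 2) (hα0 : 1 / 3 < α) (hT : 0 ≤ T) (hX : IsRoughPath α T X)
    (hXx : IsAbove T X x) (hXhat : IsBracketExtension α T X Xhat) (hF : ContDiff ℝ ∞ F)
    {I : Fin d → ℝ → E} {J : Fin d → Fin d → ℝ → E}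
    (hI : ∀ i, IsRoughIntegral α T X (liftAlong id (partialD i F) x) i (I i))
    (hJ : ∀ i j, IsRoughIntegral α T Xhat (liftAlong Sum.inl (partialD i (partialD j F)) x)
      (Sum.inr (i, j)) (J i j)) {s t : ℝ} (hs : s ∈ Icc 0 T) (ht : t ∈ Icc 0 T) :
    F (x t) - F (x s) = ∑ i, (I i t - I i s) + ∑ i, ∑ j, (J i j t - J i j s) := by
  have hexp : ((level α : ℝ) + 1) * α = 3 * α := by rw [hα]; norm_num
  have oI : ∀ i, HasOrder T (3 * α) fun s t =>
      I i t - I i s - germ X (liftAlong id (partialD i F) x) i s t := fun i => by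
    obtain ⟨C, hC⟩ := (hI i).estimate
    exact .of_bound (hexp ▸ hC)
  have oJ : ∀ i j, HasOrder T (3 * α) fun s t => J i j t - J i j s
      - germ Xhat (liftAlong Sum.inl (partialD i (partialD j F)) x) (Sum.inr (i, j)) s t :=
    fun i j => by
      obtain ⟨C, hC⟩ := (hJ i j).estimate
      exact .of_bound (hexp ▸ hC)
  -- Only the local estimates of the integrals enter, so any choice of `I` and `J` satisfying them
  -- makes `D` constant.
  set D : ℝ → E := fun t => F (x t) - ∑ i, I i t - ∑ i, ∑ j, J i j t with hD
  have hDo : HasOrder T (3 * α) fun s t => D t - D s := by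
    refine (((hasOrder_ito hX hα (by linarith) hT hXx hXhat hF).sub
      (HasOrder.sum Finset.univ oI)).sub (HasOrder.sum Finset.univ fun i =>
        HasOrder.sum Finset.univ (oJ i))).congr fun s _ t _ => ?_
    simp only [hD, Finset.sum_sub_distrib]
    abel
  obtain ⟨K, hK, hDK⟩ := hDo
  have hθ : 1 < 3 * α := by linarith
  have hconst : ∀ t ∈ Icc 0 T, D t = D 0 := fun t ht =>
    eq_of_norm_sub_le_rpow hK hθ (fun s hs t ht hst => by
      simpa only [abs_of_nonneg (sub_nonneg.2 hst)] using hDK s hs t ht) ht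
  have hst : D t - D s = 0 := by rw [hconst t ht, hconst s hs, sub_self]
  rw [← sub_eq_zero, ← hst]
  simp only [hD, Finset.sum_sub_distrib]
  abel

end Ito

end PlanarRough

theorem mainTheorem1 (d n : ℕ) (α T : ℝ) (hα₁ : 1 / 3 < α) (hα₂ : α ≤ 1 / 2) (hT : 0 < T)
    (x : ℝ → EuclideanSpace ℝ (Fin d))
    (X : ℝ → ℝ → PlanarRough.Forest (Fin d) → ℝ)
    (hX : PlanarRough.IsRoughPath α T X) (hXx : PlanarRough.IsAbove T X x)
    (Xhat : ℝ → ℝ → PlanarRough.Forest (PlanarRough.ExtLetter d) → ℝ)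
    (hXhat : PlanarRough.IsBracketExtension α T X Xhat)
    (F : EuclideanSpace ℝ (Fin d) → EuclideanSpace ℝ (Fin n)) (hF : ContDiff ℝ ∞ F) :
    (∀ i, ∃ I, PlanarRough.IsRoughIntegral α T X
      (PlanarRough.lift (PlanarRough.partialD i F) x) i I) ∧
    (∀ i j, ∃ J, PlanarRough.IsRoughIntegral α T Xhat
      (PlanarRough.extend
        (PlanarRough.lift (PlanarRough.partialD i (PlanarRough.partialD j F)) x))
      (Sum.inr (i, j)) J) ∧
    ∀ (I : Fin d → ℝ → EuclideanSpace ℝ (Fin n))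
      (J : Fin d → Fin d → ℝ → EuclideanSpace ℝ (Fin n)),
      (∀ i, PlanarRough.IsRoughIntegral α T X
        (PlanarRough.lift (PlanarRough.partialD i F) x) i (I i)) →
      (∀ i j, PlanarRough.IsRoughIntegral α T Xhat
        (PlanarRough.extend
          (PlanarRough.lift (PlanarRough.partialD i (PlanarRough.partialD j F)) x))
        (Sum.inr (i, j)) (J i j)) →
      ∀ s ∈ Set.Icc 0 T, ∀ t ∈ Set.Icc 0 T,
        F (x t) - F (x s) =
          ∑ i, (I i t - I i s) + ∑ i, ∑ j, (J i j t - J i j s) := by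
  have hα := PlanarRough.level_eq_two hα₁ hα₂
  simp only [PlanarRough.extend_lift_eq_liftAlong]
  simp only [PlanarRough.lift_eq_liftAlong]
  refine ⟨fun i => ?_, fun i j => ?_, fun I J hI hJ s hs t ht => ?_⟩
  · exact hX.exists_isRoughIntegral hα hα₁ hT.le hXx (PlanarRough.contDiff_partialD hF i) i
  · exact hXhat.isRoughPath.exists_isRoughIntegral hα hα₁ hT.le (hXhat.dot_inl hXx)
      (PlanarRough.contDiff_partialD (PlanarRough.contDiff_partialD hF j) i) _
  · exact PlanarRough.ito_formula hα hα₁ hT.le hX hXx hXhat hF hI hJ hs ht
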